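/- Let $\ell\ge 1$, $n\ge 0$ be integers, let $\omega\in\mathbb{C}$ be a primitive $\ell$-th root of unity, and let $W=S_n\wr\mathbb{Z}/\ell\mathbb{Z}=(\mathbb{Z}/\ell\mathbb{Z})^n\rtimes S_n$ act on $\mathfrak{h}=\mathbb{C}^n$ with basis $e_1,\dots,e_n$ by $\gamma_ie_i=\omega e_i$, $\gamma_ie_j=e_j$ for $j\ne i$, and $\sigma e_i=e_{\sigma(i)}$, where $\gamma_i$ denotes a fixed generator $\gamma$ of the $i$-th copy of $\mathbb{Z}/\ell\mathbb{Z}$. Let $S\subset W$ be the set of reflections, i.e. of the elements $s$ for which $1-s$ has rank one on $\mathfrak{h}$; these are the elements $\gamma_i^k$ ($1\le k\le \ell-1$) and $\sigma_{ij}\gamma_i^k\gamma_j^{-k}$ ($i\neq j$), where $\sigma_{ij}$ is the transposition of $i$ and $j$. Let $c:S\to\mathbb{C}$ be constant on conjugacy classes of $W$. Put $V=\mathfrak{h}\oplus\mathfrak{h}^*$, $\omega_V(y_1\oplus x_1,y_2\oplus x_2)=x_2(y_1)-x_1(y_2)$, and for $s\in S$ let $\omega_s$ be the skew form on $V$ that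 equals $\omega_V$ on $\mathrm{Im}(1-s)$ and has $\mathrm{Ker}(1-s)$ in its radical. Let $$H_c=H_{0,c}(W)=T(V)\rtimes W\,\big/\,\Big\langle u\otimes v-v\otimes u-\sum_{s\in S}c(s)\,\omega_s(u,v)\,s\ :\ u,v\in V\Big\rangle ,$$ which is $\mathbb{Z}$-graded with $\mathfrak{h}^*$ in degree $1$, $\mathfrak{h}$ in degree $-1$ and $W$ in degree $0$, and let $\overline{H}_c$ be the quotient of $H_c$ by the ideal generated by the $W$-invariants without constant term in $\mathbb{C}[\mathfrak{h}]$ and in $\mathbb{C}[\mathfrak{h}^*]$. Call $c$ generic if the centre $Z(H_c)$ is a regular ring. For an $\ell$-multipartition $\underline\lambda=(\lambda_1,\dots,\lambda_\ell)$ of $n$, denote also by $\underline\lambda$ the irreducible $\mathbb{C}W$-module labelled by it, namely the module induced from $\prod_i S_{n_i}\wr\mathbb{Z}/\ell\mathbb{Z}$, $n_i=|\lambda_i|$, of $\bigotimes_i S^{\lambda_i}\otimes(\chi^{i-1})^{\otimes n_i}$, where $S^{\lambda_i}$ is the Specht module of $S_{n_i}$ and $\chi(\gamma)=\omega$. Let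 $\Delta_c(\underline\lambda)$ be the $\overline{H}_c$-module induced from the module $\underline\lambda$ over the subalgebra generated by $\mathfrak{h}$ and $W$, with $\mathfrak{h}$ acting by $0$, and let $\Delta_c^*(\underline\lambda)$ be the $\overline{H}_c$-module induced from the module $\underline\lambda$ over the subalgebra generated by $\mathfrak{h}^*$ and $W$, with $\mathfrak{h}^*$ acting by $0$. Both are graded, with $\underline\lambda$ in degree $0$. Let $$A_c(\underline\lambda)^+=\mathrm{End}_{\overline{H}_c}(\Delta_c(\underline\lambda)),\qquad A_c(\underline\lambda)^-=\mathrm{End}_{\overline{H}_c}(\Delta^*_c(\underline\lambda)),$$ where an endomorphism has degree $d$ if it raises degrees by $d$. Define $\overline c(\gamma_i^k)=c(\gamma_i^{-k})$, $\overline c(\sigma_{ij}\gamma_i^k\gamma_j^{-k})=c(\sigma_{ij}\gamma_i^k\gamma_j^{-k})$, and $\underline\lambda^*=(\lambda_1,\lambda_\ell,\lambda_{\ell-1},\dots,\lambda_2)$. Then for every $\ell$-multipartition $\underline\lambda$ of $n$ there is an isomorphism of $\mathbb{C}$-algebras $$A_{\overline c}(\underline\lambda^*)^-\;\cong\;A_c(\underline\lambda)^+$$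 under which an element has degree $d$ if and only if its image has degree $-d$ (an anti-graded isomorphism), for every $d\in\mathbb{Z}$. Moreover, $\overline c$ is generic if and only if $c$ is generic. -/

import Mathlib

open scoped TensorProduct

noncomputable section

namespace Cherednik

/-! ## Rational Cherednik algebras -/

section General

variable {W : Type*} [Group W] {h : Type*} [AddCommGroup h] [Module ℂ h]

/-- The representation of `W` on `V = 𝔥 ⊕ 𝔥*`. -/
def doubled (ρ : Representation ℂ W h) : Representation ℂ W (h × Module.Dual ℂ h) :=
  ρ.prod ρ.dual

/-- `s` acts on `𝔥` as a (complex) reflection: `1 - s` has rank one. -/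
def IsReflection (ρ : Representation ℂ W h) (s : W) : Prop :=
  Module.finrank ℂ (LinearMap.range (1 - ρ s)) = 1

/-- A class function `c : S → ℂ` on the set `S` of reflections of `W`. -/
structure ReflParam (ρ : Representation ℂ W h) where
  /-- the underlying function -/
  toFun : {s : W // IsReflection ρ s} → ℂ
  /-- it is constant on conjugacy classes -/
  map_conj : ∀ s s' : {s : W // IsReflection ρ s}, IsConj (s : W) (s' : W) → toFun s = toFun s'

/-- The standard symplectic form on `V = 𝔥 ⊕ 𝔥*`:
`ω(y₁ ⊕ x₁, y₂ ⊕ x₂) = (y₁, x₂) - (y₂, x₁)`, where `(y, x) = x(y)`. -/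
def symp (u v : h × Module.Dual ℂ h) : ℂ := v.2 u.1 - u.2 v.1

/-- For `s` of finite order, the projection of `V` onto `Im (1 - s)` along `Ker (1 - s)`,
i.e. `u ↦ u - (1/N) ∑_{k < N} sᵏ u` with `N` the order of `s`. -/
def reflProj (ρ : Representation ℂ W h) (s : W) :
    (h × Module.Dual ℂ h) →ₗ[ℂ] (h × Module.Dual ℂ h) :=
  1 - ((orderOf s : ℂ)⁻¹) • ∑ k ∈ Finset.range (orderOf s), doubled ρ (s ^ k)

theorem reflProj_of_mem_ker [Finite W] (ρ : Representation ℂ W h) (s : W)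
    (u : h × Module.Dual ℂ h) (hu : u ∈ LinearMap.ker (1 - doubled ρ s)) :
    reflProj ρ s u = 0 := by
  have h1 : doubled ρ s u = u := by
    have := LinearMap.mem_ker.1 hu
    simp only [LinearMap.sub_apply, Module.End.one_apply] at this
    exact (sub_eq_zero.1 this).symm
  have h2 : ∀ k : ℕ, doubled ρ (s ^ k) u = u := by
    intro k
    induction k with
    | zero => simp
    | succ k ih => rw [pow_succ, map_mul, Module.End.mul_apply, h1, ih]
  have h3 : (orderOf s : ℂ) ≠ 0 := by
    exact_mod_cast (orderOf_pos s).ne'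
  simp only [reflProj, LinearMap.sub_apply, Module.End.one_apply, LinearMap.smul_apply,
    LinearMap.sum_apply, h2, Finset.sum_const, Finset.card_range]
  rw [← Nat.cast_smul_eq_nsmul ℂ, smul_smul, inv_mul_cancel₀ h3, one_smul, sub_self]

theorem reflProj_of_mem_range (ρ : Representation ℂ W h) (s : W)
    (u : h × Module.Dual ℂ h) (hu : u ∈ LinearMap.range (1 - doubled ρ s)) :
    reflProj ρ s u = u := by
  obtain ⟨v, rfl⟩ := hu
  have h2 : ∀ N : ℕ, ∑ k ∈ Finset.range N, doubled ρ (s ^ k) ((1 - doubled ρ s) v)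
      = v - doubled ρ (s ^ N) v := by
    intro N
    induction N with
    | zero => simp
    | succ N ih =>
      rw [Finset.sum_range_succ, ih, pow_succ, map_mul]
      simp
  have h3 := h2 (orderOf s)
  rw [pow_orderOf_eq_one, map_one, Module.End.one_apply, sub_self] at h3
  simp only [reflProj, LinearMap.sub_apply (1 : Module.End ℂ _) (_ • _), LinearMap.smul_apply,
    LinearMap.sum_apply, h3]
  simp

/-- The form `ω_s`, equal to `ω` on `Im (1 - s)` and `0` on `Ker (1 - s)`. -/
def reflForm (ρ : Representation ℂ W h) (s : W) (u v : h × Module.Dual ℂ h) : ℂ :=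
  symp (reflProj ρ s u) (reflProj ρ s v)

/-- Generators of the rational Cherednik algebra: the vectors of `V` and the elements of `W`. -/
abbrev PreAlg (W h : Type*) [AddCommGroup h] [Module ℂ h] : Type _ :=
  FreeAlgebra ℂ ((h × Module.Dual ℂ h) ⊕ W)

/-- `κ(u, v) = t ω(u, v) · 1 + ∑_{s ∈ S} c(s) ω_s(u, v) · s`. -/
def kappa (ρ : Representation ℂ W h) (t : ℂ) (c : ReflParam ρ)
    (u v : h × Module.Dual ℂ h) : PreAlg W h :=
  (t * symp u v) • 1 +
    ∑ᶠ s : {s : W // IsReflection ρ s},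
      (c.toFun s * reflForm ρ (s : W) u v) • FreeAlgebra.ι ℂ (Sum.inr (s : W))

/-- The defining relations. The first five families present `T(V) ⋊ W`; the last one imposes
`u ⊗ v - v ⊗ u = κ(u, v)` for all `u, v ∈ V`. -/
inductive Rel (ρ : Representation ℂ W h) (t : ℂ) (c : ReflParam ρ) :
    PreAlg W h → PreAlg W h → Prop
  | add (u v : h × Module.Dual ℂ h) : Rel ρ t c (FreeAlgebra.ι ℂ (Sum.inl (u + v)))
      (FreeAlgebra.ι ℂ (Sum.inl u) + FreeAlgebra.ι ℂ (Sum.inl v))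
  | smul (a : ℂ) (u : h × Module.Dual ℂ h) : Rel ρ t c (FreeAlgebra.ι ℂ (Sum.inl (a • u)))
      (a • FreeAlgebra.ι ℂ (Sum.inl u))
  | one : Rel ρ t c (FreeAlgebra.ι ℂ (Sum.inr 1)) 1
  | mul (w w' : W) : Rel ρ t c (FreeAlgebra.ι ℂ (Sum.inr (w * w')))
      (FreeAlgebra.ι ℂ (Sum.inr w) * FreeAlgebra.ι ℂ (Sum.inr w'))
  | act (w : W) (u : h × Module.Dual ℂ h) :
      Rel ρ t c (FreeAlgebra.ι ℂ (Sum.inr w) * FreeAlgebra.ι ℂ (Sum.inl u))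
        (FreeAlgebra.ι ℂ (Sum.inl (doubled ρ w u)) * FreeAlgebra.ι ℂ (Sum.inr w))
  | comm (u v : h × Module.Dual ℂ h) :
      Rel ρ t c (FreeAlgebra.ι ℂ (Sum.inl u) * FreeAlgebra.ι ℂ (Sum.inl v) -
          FreeAlgebra.ι ℂ (Sum.inl v) * FreeAlgebra.ι ℂ (Sum.inl u))
        (kappa ρ t c u v)

/-- The rational Cherednik algebra `H_{t,c}(W) = T(V) ⋊ W / (u ⊗ v - v ⊗ u - κ(u, v))` of a finite
group `W` acting on `𝔥`. -/
def RCA [Finite W] (ρ : Representation ℂ W h) (t : ℂ) (c : ReflParam ρ) : Type _ :=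
  RingQuot (Rel ρ t c)

instance [Finite W] (ρ : Representation ℂ W h) (t : ℂ) (c : ReflParam ρ) : Ring (RCA ρ t c) :=
  inferInstanceAs (Ring (RingQuot (Rel ρ t c)))

instance [Finite W] (ρ : Representation ℂ W h) (t : ℂ) (c : ReflParam ρ) : Algebra ℂ (RCA ρ t c) :=
  inferInstanceAs (Algebra ℂ (RingQuot (Rel ρ t c)))

/-- The quotient map onto the rational Cherednik algebra. -/
def toRCA [Finite W] (ρ : Representation ℂ W h) (t : ℂ) (c : ReflParam ρ) :
    PreAlg W h →ₐ[ℂ] RCA ρ t c :=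
  RingQuot.mkAlgHom ℂ (Rel ρ t c)

variable [Finite W] {ρ : Representation ℂ W h}

/-- The image of `u ∈ V` in `H_{t,c}(W)`. -/
def vec (t : ℂ) (c : ReflParam ρ) (u : h × Module.Dual ℂ h) : RCA ρ t c :=
  toRCA ρ t c (FreeAlgebra.ι ℂ (Sum.inl u))

/-- The image of `w ∈ W` in `H_{t,c}(W)`. -/
def grp (t : ℂ) (c : ReflParam ρ) (w : W) : RCA ρ t c :=
  toRCA ρ t c (FreeAlgebra.ι ℂ (Sum.inr w))

/-- The parameter `c` is generic if the centre of `H_{0,c}(W)` is a regular ring. -/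
def IsGeneric (c : ReflParam ρ) : Prop :=
  IsRegularRing (Subalgebra.center ℂ (RCA ρ 0 c))

/-- The grading of `H_{t,c}(W)` with `𝔥*` in degree `1`, `𝔥` in degree `-1` and `W` in degree `0`:
`IsHomogeneous t c d a` says that `a` lies in the component of degree `d`, which is spanned by the
products of generators of total degree `d`. -/
inductive IsHomogeneous (t : ℂ) (c : ReflParam ρ) : ℤ → RCA ρ t c → Prop
  | zero (d : ℤ) : IsHomogeneous t c d 0
  | one : IsHomogeneous t c 0 1
  | ofGroup (w : W) : IsHomogeneous t c 0 (grp t c w)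
  | ofDual (x : Module.Dual ℂ h) : IsHomogeneous t c 1 (vec t c (0, x))
  | ofVector (y : h) : IsHomogeneous t c (-1) (vec t c (y, 0))
  | add {d : ℤ} {a b : RCA ρ t c} :
      IsHomogeneous t c d a → IsHomogeneous t c d b → IsHomogeneous t c d (a + b)
  | smul {d : ℤ} (r : ℂ) {a : RCA ρ t c} : IsHomogeneous t c d a → IsHomogeneous t c d (r • a)
  | mul {d e : ℤ} {a b : RCA ρ t c} :
      IsHomogeneous t c d a → IsHomogeneous t c e b → IsHomogeneous t c (d + e) (a * b)

/-! ## Restricted rational Cherednik algebras -/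

/-- The image of `ℂ[𝔥]₊` in `H_{0,c}(W)`: polynomials without constant term in `𝔥*`. -/
def polyPlus (c : ReflParam ρ) : NonUnitalSubalgebra ℂ (RCA ρ 0 c) :=
  NonUnitalAlgebra.adjoin ℂ (Set.range fun x : Module.Dual ℂ h => vec 0 c (0, x))

/-- The image of `ℂ[𝔥*]₊` in `H_{0,c}(W)`: polynomials without constant term in `𝔥`. -/
def dualPolyPlus (c : ReflParam ρ) : NonUnitalSubalgebra ℂ (RCA ρ 0 c) :=
  NonUnitalAlgebra.adjoin ℂ (Set.range fun y : h => vec 0 c (y, 0))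

/-- The generators `ℂ[𝔥]₊^W ∪ ℂ[𝔥*]₊^W` of the ideal `R₊`; `W` acts on polynomials in `H_{0,c}(W)`
by conjugation, so that invariant means commuting with `W`. -/
def rPlus (c : ReflParam ρ) : Set (RCA ρ 0 c) :=
  {z | (z ∈ polyPlus c ∨ z ∈ dualPolyPlus c) ∧ ∀ w : W, grp 0 c w * z = z * grp 0 c w}

/-- The relations `z = 0` for `z` in the generating set of `R₊`. -/
def RestrictedRel (c : ReflParam ρ) (a b : RCA ρ 0 c) : Prop :=
  a ∈ rPlus c ∧ b = 0

/-- The restricted rational Cherednik algebra `H_{0,c}(W) / R₊ H_{0,c}(W)`, the quotient by the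
(two-sided) ideal generated by `R₊`. -/
def RestrictedRCA (c : ReflParam ρ) : Type _ :=
  RingQuot (RestrictedRel c)

instance (c : ReflParam ρ) : Ring (RestrictedRCA c) :=
  inferInstanceAs (Ring (RingQuot (RestrictedRel c)))

instance (c : ReflParam ρ) : Algebra ℂ (RestrictedRCA c) :=
  inferInstanceAs (Algebra ℂ (RingQuot (RestrictedRel c)))

/-- The quotient map from `H_{0,c}(W)` to the restricted rational Cherednik algebra. -/
def toRestricted (c : ReflParam ρ) : RCA ρ 0 c →ₐ[ℂ] RestrictedRCA c :=
  RingQuot.mkAlgHom ℂ (RestrictedRel c)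

/-! ## Baby Verma modules and their endomorphism algebras -/

section Verma

variable (c : ReflParam ρ) (L : Type*) [AddCommGroup L] [Module ℂ L]
  [Module (MonoidAlgebra ℂ W) L] [IsScalarTower ℂ (MonoidAlgebra ℂ W) L]

/-- The relations `a w ⊗ v = a ⊗ w v` (`w ∈ W`) and `a u ⊗ v = 0` (`u ∈ U`) in `H̄_c(W) ⊗_ℂ L`. -/
def vermaRel (U : Set (h × Module.Dual ℂ h)) :
    Submodule (RestrictedRCA c) (RestrictedRCA c ⊗[ℂ] L) :=
  Submodule.span (RestrictedRCA c)
    ({m | ∃ (a : RestrictedRCA c) (w : W) (v : L), m = (a * toRestricted c (grp 0 c w)) ⊗ₜ[ℂ] v -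
        a ⊗ₜ[ℂ] (MonoidAlgebra.of ℂ W w • v)} ∪
      {m | ∃ (a : RestrictedRCA c) (u : h × Module.Dual ℂ h) (v : L), u ∈ U ∧
        m = (a * toRestricted c (vec 0 c u)) ⊗ₜ[ℂ] v})

/-- The `H̄_c(W)`-module induced from the `ℂW`-module `L` on which the vectors in `U` act as zero. -/
abbrev Induced (U : Set (h × Module.Dual ℂ h)) : Type _ :=
  (RestrictedRCA c ⊗[ℂ] L) ⧸ vermaRel c L U

/-- The vectors `𝔥 ⊂ V`. -/
def vectors (h : Type*) [AddCommGroup h] [Module ℂ h] : Set (h × Module.Dual ℂ h) :=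
  {u | u.2 = 0}

/-- The covectors `𝔥* ⊂ V`. -/
def covectors (h : Type*) [AddCommGroup h] [Module ℂ h] : Set (h × Module.Dual ℂ h) :=
  {u | u.1 = 0}

/-- The baby Verma module `Δ_c(L) = H̄_c(W) ⊗_{ℂ[𝔥*]^{coW} ⋊ W} L`, where `𝔥` acts as `0` on `L`.
As `ℂ[𝔥*]^{coW} ⋊ W` is generated by `𝔥` and `W`, it suffices to balance over these. -/
abbrev Delta : Type _ := Induced c L (vectors h)

/-- The module `Δ*_c(L) = H̄_c(W) ⊗_{ℂ[𝔥]^{coW} ⋊ W} L`, where `𝔥*` acts as `0` on `L`. -/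
abbrev DeltaStar : Type _ := Induced c L (covectors h)

/-- `A_c(L)⁺`, the endomorphism algebra of `Δ_c(L)`. -/
abbrev APlus : Type _ := Module.End (RestrictedRCA c) (Delta c L)

/-- `A_c(L)⁻`, the endomorphism algebra of `Δ*_c(L)`. -/
abbrev AMinus : Type _ := Module.End (RestrictedRCA c) (DeltaStar c L)

/-- The degree `d` component of an induced module, `L` being in degree `0`. -/
def inducedDeg (U : Set (h × Module.Dual ℂ h)) (d : ℤ) : Submodule ℂ (Induced c L U) :=
  Submodule.span ℂ {m | ∃ (a : RCA ρ 0 c) (v : L), IsHomogeneous 0 c d a ∧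
    m = (vermaRel c L U).mkQ (toRestricted c a ⊗ₜ[ℂ] v)}

/-- The degree `d` component of the endomorphism algebra of an induced module: the endomorphisms
which raise degrees by `d`. -/
def IsHomogeneousEnd (U : Set (h × Module.Dual ℂ h)) (d : ℤ)
    (f : Module.End (RestrictedRCA c) (Induced c L U)) : Prop :=
  ∀ (k : ℤ), ∀ m ∈ inducedDeg c L U k, f m ∈ inducedDeg c L U (k + d)

end Verma

end General

/-! ## The wreath product `S_n ≀ ℤ/ℓℤ` -/

section Wreath

/-- The wreath product `S_n ≀ ℤ/ℓℤ = (ℤ/ℓℤ)ⁿ ⋊ S_n`; here `σ γ_i σ⁻¹ = γ_{σ(i)}`. -/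
abbrev Wreath (ℓ n : ℕ) : Type :=
  (Fin n → Multiplicative (ZMod ℓ)) ⋊[mulAutArrow] Equiv.Perm (Fin n)

instance (ℓ n : ℕ) [NeZero ℓ] : Finite (Wreath ℓ n) :=
  Finite.of_equiv _ SemidirectProduct.equivProd.symm

variable {ℓ : ℕ} [NeZero ℓ] {ω : ℂ}

/-- The character of `ℤ/ℓℤ` sending the generator `γ` to the primitive root of unity `ω`. -/
def cyclicChar (hω : IsPrimitiveRoot ω ℓ) : Multiplicative (ZMod ℓ) →* ℂ :=
  (AddChar.zmodChar ℓ hω.pow_eq_one).toMonoidHom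

/-- The reflection representation of `S_n ≀ ℤ/ℓℤ` on `𝔥 = ℂⁿ`: on the standard basis `e_1, …, e_n`,
`γ_i e_i = ω e_i`, `γ_i e_j = e_j` for `j ≠ i`, and `σ e_i = e_{σ(i)}`. -/
def wreathRep (n : ℕ) (hω : IsPrimitiveRoot ω ℓ) : Representation ℂ (Wreath ℓ n) (Fin n → ℂ) where
  toFun w :=
    { toFun := fun v j => cyclicChar hω (w.left j) * v (w.right⁻¹ j)
      map_add' := fun u v => by ext j; simp [mul_add]
      map_smul' := fun a v => by ext j; simp [mul_left_comm] }
  map_one' := by ext v j; simp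
  map_mul' w w' := by
    refine LinearMap.ext fun v => funext fun j => ?_
    change cyclicChar hω (w.left j * w'.left (w.right⁻¹ j)) * v ((w.right * w'.right)⁻¹ j) =
      cyclicChar hω (w.left j) * (cyclicChar hω (w'.left (w.right⁻¹ j)) *
        v (w'.right⁻¹ (w.right⁻¹ j)))
    rw [map_mul, mul_assoc, mul_inv_rev, Equiv.Perm.mul_apply]

theorem isReflection_inv {W : Type*} [Group W] {h : Type*} [AddCommGroup h] [Module ℂ h]
    (ρ : Representation ℂ W h) {s : W} (hs : IsReflection ρ s) : IsReflection ρ s⁻¹ := by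
  have h1 : (1 - ρ s⁻¹) = (1 - ρ s) * (-ρ s⁻¹) := by
    rw [mul_neg, sub_mul, one_mul, ← map_mul, mul_inv_cancel, map_one]; abel
  have h2 : LinearMap.range (-ρ s⁻¹) = ⊤ := by
    rw [LinearMap.range_eq_top]
    intro v
    refine ⟨-ρ s v, ?_⟩
    simp
  unfold IsReflection at *
  rw [h1, Module.End.mul_eq_comp, LinearMap.range_comp_of_range_eq_top _ h2, hs]

open Classical in
/-- The parameter `c̄`. The reflections with trivial image in `S_n` are the `γ_i^k` (`k ≠ 0`), on
which `c̄(γ_i^k) = c(γ_i^{-k})`; on all others, which are the `σ_{ij} γ_i^k γ_j^{-k}`, `c̄ = c`. -/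
def barParam {n : ℕ} {hω : IsPrimitiveRoot ω ℓ} (c : ReflParam (wreathRep n hω)) :
    ReflParam (wreathRep n hω) where
  toFun s := if (s : Wreath ℓ n).right = 1 then c.toFun ⟨(s : Wreath ℓ n)⁻¹, isReflection_inv _ s.2⟩
    else c.toFun s
  map_conj s s' hss := by
    have h1 : (s : Wreath ℓ n).right = 1 ↔ (s' : Wreath ℓ n).right = 1 := by
      obtain ⟨g, hg⟩ := isConj_iff.1 hss
      rw [← hg]
      simp
    by_cases hs : (s : Wreath ℓ n).right = 1
    · rw [if_pos hs, if_pos (h1.1 hs)]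
      refine c.map_conj _ _ ?_
      obtain ⟨g, hg⟩ := isConj_iff.1 hss
      exact isConj_iff.2 ⟨g, by simp [← hg, mul_assoc]⟩
    · rw [if_neg hs, if_neg fun h => hs (h1.2 h)]
      exact c.map_conj _ _ hss

/-! ### Multipartitions and irreducible representations -/

/-- An `ℓ`-multipartition of `n`: an `ℓ`-tuple of partitions (given by their Young diagrams) with
`n` cells in total. The components are indexed by `0, …, ℓ - 1`. -/
structure Multipartition (ℓ n : ℕ) where
  /-- the components -/
  parts : Fin ℓ → YoungDiagram
  /-- the total size is `n` -/
  card_eq : ∑ i, (parts i).card = n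

/-- `(λ_1, …, λ_ℓ)* = (λ_1, λ_ℓ, …, λ_2)`: with indices `0, …, ℓ - 1`, the component `i` of `λ*` is
the component `-i` (modulo `ℓ`) of `λ`. -/
def Multipartition.star {n : ℕ} (μ : Multipartition ℓ n) : Multipartition ℓ n where
  parts i := μ.parts (-i)
  card_eq := by
    refine Eq.trans ?_ μ.card_eq
    exact Equiv.sum_comp (Equiv.neg (Fin ℓ)) fun i => (μ.parts i).card

/-- The cells of a multipartition. -/
abbrev Multipartition.Cell {ℓ n : ℕ} (μ : Multipartition ℓ n) : Type :=
  Σ i : Fin ℓ, {x : ℕ × ℕ // x ∈ (μ.parts i).cells}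

/-- A tableau of shape `μ`: a numbering of the cells (any choice gives the same irreducible
representation up to isomorphism). -/
def Multipartition.tableau {ℓ n : ℕ} (μ : Multipartition ℓ n) : μ.Cell ≃ Fin n :=
  Fintype.equivFinOfCardEq (by
    refine Eq.trans ?_ μ.card_eq
    rw [Fintype.card_sigma]
    exact Finset.sum_congr rfl fun i _ => Fintype.card_coe _)

/-- The component, row and column of the cell numbered `k`. -/
def Multipartition.comp {ℓ n : ℕ} (μ : Multipartition ℓ n) (k : Fin n) : Fin ℓ :=
  (μ.tableau.symm k).1

/-- The row, within its component, of the cell numbered `k`. -/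
def Multipartition.row {ℓ n : ℕ} (μ : Multipartition ℓ n) (k : Fin n) : ℕ :=
  (μ.tableau.symm k).2.1.1

/-- The column, within its component, of the cell numbered `k`. -/
def Multipartition.col {ℓ n : ℕ} (μ : Multipartition ℓ n) (k : Fin n) : ℕ :=
  (μ.tableau.symm k).2.1.2

/-- The row symmetrizer: the sum of the permutations preserving all rows. -/
def Multipartition.rowSym {n : ℕ} (μ : Multipartition ℓ n) : MonoidAlgebra ℂ (Wreath ℓ n) :=
  ∑ σ : Equiv.Perm (Fin n) with ∀ k, μ.comp (σ k) = μ.comp k ∧ μ.row (σ k) = μ.row k,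
    MonoidAlgebra.of ℂ (Wreath ℓ n) (SemidirectProduct.inr σ)

/-- The column antisymmetrizer: the signed sum of the permutations preserving all columns. -/
def Multipartition.colSym {n : ℕ} (μ : Multipartition ℓ n) : MonoidAlgebra ℂ (Wreath ℓ n) :=
  ∑ σ : Equiv.Perm (Fin n) with ∀ k, μ.comp (σ k) = μ.comp k ∧ μ.col (σ k) = μ.col k,
    ((Equiv.Perm.sign σ : ℤ) : ℂ) • MonoidAlgebra.of ℂ (Wreath ℓ n) (SemidirectProduct.inr σ)

/-- The (unnormalized) idempotent of the character of `(ℤ/ℓℤ)ⁿ` under which `γ_k` acts as `ω^i` if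
the cell numbered `k` lies in the component `i`. -/
def Multipartition.charSym {n : ℕ} (hω : IsPrimitiveRoot ω ℓ) (μ : Multipartition ℓ n) :
    MonoidAlgebra ℂ (Wreath ℓ n) :=
  ∑ f : Fin n → Multiplicative (ZMod ℓ),
    (∏ k, cyclicChar hω (f k) ^ (μ.comp k : ℕ))⁻¹ •
      MonoidAlgebra.of ℂ (Wreath ℓ n) (SemidirectProduct.inl f)

/-- The irreducible `ℂ[S_n ≀ ℤ/ℓℤ]`-module labelled by `(λ_1, …, λ_ℓ)`, namely
`Ind (⨂_i S^{λ_i} ⊗ (χ^{i-1})^{⊗ n_i})` from `∏_i S_{n_i} ≀ ℤ/ℓℤ`, where `n_i = |λ_i|`, `S^{λ_i}` is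
the Specht module and `χ(γ) = ω`. It is realized as the left ideal generated by the product of the
idempotent of a character of `(ℤ/ℓℤ)ⁿ` and a Young symmetrizer. -/
abbrev Irrep {n : ℕ} (hω : IsPrimitiveRoot ω ℓ) (μ : Multipartition ℓ n) : Type :=
  (Ideal.span {μ.charSym hω * (μ.rowSym * μ.colSym)} : Ideal (MonoidAlgebra ℂ (Wreath ℓ n)))

end Wreath

end Cherednik

end

/-!
The proof rests on a Fourier transform which exchanges `𝔥` and `𝔥*`. Let `φ : 𝔥 ≃ 𝔥*` send the
standard basis to its dual basis. Since `γ_i` acts by `ω⁻¹` on the dual basis vector of `e_i`, the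
map `φ` is equivariant up to the automorphism `Wreath.flip` of `W`, which sends `γ_i` to `γ_i⁻¹` and
fixes `S_n` (`dotProductEquiv_wreathRep`). Hence `(y, x) ↦ (-φ⁻¹ x, φ y)` is a symplectic
automorphism of `𝔥 ⊕ 𝔥*`, semi-equivariant for the flip, and together they define an isomorphism
`H_{c ∘ flip} ≃ H_c` which reverses the grading. The flip inverts `γ_i^k` and sends
`σ_{ij} γ_i^k γ_j^{-k}` to its conjugate under `σ_{ij}` (`isConj_flip`), so `c ∘ flip = c̄`
(`barParam_eq`). The centres of `H_c̄` and `H_c` are therefore isomorphic, which is the statement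
about generic parameters.

The isomorphism preserves the invariants that are killed in the restricted algebras and carries the
subalgebra generated by `𝔥*` and `W` to the one generated by `𝔥` and `W`. So it identifies
`Δ*_c̄(L')` with `Δ_c(L)`, reversing degrees, whenever `L'` is the twist of `L` by the flip
(`FourierTransform.inducedEquiv`), and it identifies the endomorphism algebras likewise
(`FourierTransform.endEquiv`). Finally the twist of `μ` by the flip is `μ*`: the flip turns the
character `γ ↦ ω^i` into `γ ↦ ω^(-i)` and leaves the Young symmetrizers alone, so that, up to
conjugation by the permutation comparing the chosen tableaux, it carries the generator of the left
ideal `μ*` to that of the left ideal `μ` (`starUnit_mul_irrepGen`, `irrepEquiv`).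
-/

noncomputable section

namespace Cherednik

/-! ### Relations in the Cherednik algebra -/

section Relations

variable {W h : Type*} [Group W] [Finite W] [AddCommGroup h] [Module ℂ h]
  {ρ : Representation ℂ W h}

theorem vec_add (t : ℂ) (c : ReflParam ρ) (u v : h × Module.Dual ℂ h) :
    vec t c (u + v) = vec t c u + vec t c v := by
  rw [vec, vec, vec, ← map_add]
  exact RingQuot.mkAlgHom_rel ℂ (.add u v)

theorem vec_smul (t : ℂ) (c : ReflParam ρ) (a : ℂ) (u : h × Module.Dual ℂ h) :
    vec t c (a • u) = a • vec t c u := by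
  rw [vec, vec, ← map_smul]
  exact RingQuot.mkAlgHom_rel ℂ (.smul a u)

theorem grp_one (t : ℂ) (c : ReflParam ρ) : grp t c 1 = 1 := by
  rw [grp, ← map_one (toRCA ρ t c)]
  exact RingQuot.mkAlgHom_rel ℂ .one

theorem grp_mul (t : ℂ) (c : ReflParam ρ) (w w' : W) :
    grp t c (w * w') = grp t c w * grp t c w' := by
  rw [grp, grp, grp, ← map_mul]
  exact RingQuot.mkAlgHom_rel ℂ (.mul w w')

theorem grp_mul_vec (t : ℂ) (c : ReflParam ρ) (w : W) (u : h × Module.Dual ℂ h) :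
    grp t c w * vec t c u = vec t c (doubled ρ w u) * grp t c w := by
  rw [grp, vec, vec, ← map_mul, ← map_mul]
  exact RingQuot.mkAlgHom_rel ℂ (.act w u)

/-- The image of `κ(u, v)` in the Cherednik algebra. -/
theorem toRCA_kappa (t : ℂ) (c : ReflParam ρ) (u v : h × Module.Dual ℂ h) :
    toRCA ρ t c (kappa ρ t c u v) = (t * symp u v) • 1 +
      ∑ᶠ s : {s : W // IsReflection ρ s},
        (c.toFun s * reflForm ρ (s : W) u v) • grp t c (s : W) := by
  rw [kappa, map_add, map_smul, map_one, map_finsum _ (Set.toFinite _)]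
  simp only [map_smul, grp]

theorem vec_mul_vec_sub (t : ℂ) (c : ReflParam ρ) (u v : h × Module.Dual ℂ h) :
    vec t c u * vec t c v - vec t c v * vec t c u = (t * symp u v) • 1 +
      ∑ᶠ s : {s : W // IsReflection ρ s},
        (c.toFun s * reflForm ρ (s : W) u v) • grp t c (s : W) := by
  rw [← toRCA_kappa, vec, vec, ← map_mul, ← map_mul, ← map_sub]
  exact RingQuot.mkAlgHom_rel ℂ (.comm u v)

end Relations

/-! ### Fourier transforms of rational Cherednik algebras -/

/-- A Fourier transform from the parameter `c` for `(W, 𝔥)` to the parameter `c'` for `(W', 𝔥')`: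
an isomorphism `W ≃ W'` and a compatible symplectic isomorphism
`𝔥 ⊕ 𝔥* ≃ 𝔥' ⊕ 𝔥'*` which exchanges vectors and covectors, such that reflections and their
parameters correspond. -/
structure FourierTransform {W h W' h' : Type*} [Group W] [AddCommGroup h] [Module ℂ h]
    [Group W'] [AddCommGroup h'] [Module ℂ h'] {ρ : Representation ℂ W h}
    {ρ' : Representation ℂ W' h'} (c : ReflParam ρ) (c' : ReflParam ρ') where
  /-- the isomorphism of groups -/
  groupEquiv : W ≃* W'
  /-- the symplectic isomorphism -/
  vecEquiv : (h × Module.Dual ℂ h) ≃ₗ[ℂ] (h' × Module.Dual ℂ h')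
  vecEquiv_doubled : ∀ w u, vecEquiv (doubled ρ w u) = doubled ρ' (groupEquiv w) (vecEquiv u)
  symp_vecEquiv : ∀ u v, symp (vecEquiv u) (vecEquiv v) = symp u v
  isReflection_iff : ∀ s, IsReflection ρ' (groupEquiv s) ↔ IsReflection ρ s
  param_eq : ∀ s hs hs', c'.toFun ⟨groupEquiv s, hs'⟩ = c.toFun ⟨s, hs⟩
  snd_eq_zero_iff : ∀ u, (vecEquiv u).2 = 0 ↔ u.1 = 0
  fst_eq_zero_iff : ∀ u, (vecEquiv u).1 = 0 ↔ u.2 = 0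

namespace FourierTransform

variable {W h W' h' : Type*} [Group W] [AddCommGroup h] [Module ℂ h]
    [Group W'] [AddCommGroup h'] [Module ℂ h'] {ρ : Representation ℂ W h}
    {ρ' : Representation ℂ W' h'} {c : ReflParam ρ} {c' : ReflParam ρ'}

/-- The inverse of a Fourier transform. -/
def symm (F : FourierTransform c c') : FourierTransform c' c where
  groupEquiv := F.groupEquiv.symm
  vecEquiv := F.vecEquiv.symm
  vecEquiv_doubled w u := by
    rw [LinearEquiv.symm_apply_eq, F.vecEquiv_doubled]; simp
  symp_vecEquiv u v := by rw [← F.symp_vecEquiv]; simp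
  isReflection_iff s := by rw [← F.isReflection_iff]; simp
  param_eq s hs hs' := by
    rw [← F.param_eq _ hs' (by simpa using hs)]
    simp
  snd_eq_zero_iff u := by rw [← F.fst_eq_zero_iff]; simp
  fst_eq_zero_iff u := by rw [← F.snd_eq_zero_iff]; simp

theorem reflProj_groupEquiv (F : FourierTransform c c') (s : W) (u : h × Module.Dual ℂ h) :
    reflProj ρ' (F.groupEquiv s) (F.vecEquiv u) = F.vecEquiv (reflProj ρ s u) := by
  simp only [reflProj, LinearMap.sub_apply, Module.End.one_apply, LinearMap.smul_apply,
    LinearMap.sum_apply, map_sub, map_smul, map_sum, F.vecEquiv_doubled, ← map_pow F.groupEquiv,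
    MulEquiv.orderOf_eq]

theorem reflForm_groupEquiv (F : FourierTransform c c') (s : W) (u v : h × Module.Dual ℂ h) :
    reflForm ρ' (F.groupEquiv s) (F.vecEquiv u) (F.vecEquiv v) = reflForm ρ s u v := by
  rw [reflForm, reflForm, F.reflProj_groupEquiv, F.reflProj_groupEquiv, F.symp_vecEquiv]

/-- The bijection between the reflections of `W` and of `W'`. -/
def reflEquiv (F : FourierTransform c c') :
    {s : W // IsReflection ρ s} ≃ {s : W' // IsReflection ρ' s} :=
  F.groupEquiv.toEquiv.subtypeEquiv fun s => (F.isReflection_iff s).symm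

theorem symm_of_smul {L L' : Type*} [AddCommGroup L] [Module ℂ L] [Module (MonoidAlgebra ℂ W) L]
    [AddCommGroup L'] [Module ℂ L'] [Module (MonoidAlgebra ℂ W') L'] (F : FourierTransform c c')
    (θ : L ≃ₗ[ℂ] L') (hθ : ∀ (w : W) (v : L), θ (MonoidAlgebra.of ℂ W w • v) =
      MonoidAlgebra.of ℂ W' (F.groupEquiv w) • θ v) (w : W') (v : L') :
    θ.symm (MonoidAlgebra.of ℂ W' w • v) =
      MonoidAlgebra.of ℂ W (F.symm.groupEquiv w) • θ.symm v := by
  rw [LinearEquiv.symm_apply_eq, hθ, θ.apply_symm_apply]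
  congr 2
  exact (F.groupEquiv.apply_symm_apply w).symm

theorem symm_mem_iff (F : FourierTransform c c') {U : Set (h × Module.Dual ℂ h)}
    {U' : Set (h' × Module.Dual ℂ h')} (hU : ∀ u, F.vecEquiv u ∈ U' ↔ u ∈ U)
    (u : h' × Module.Dual ℂ h') : F.symm.vecEquiv u ∈ U ↔ u ∈ U' := by
  rw [← hU]
  exact iff_of_eq (congrArg (· ∈ U') (F.vecEquiv.apply_symm_apply u))

variable [Finite W] [Finite W']

/-- The homomorphism from the free algebra to `H_{t,c'}` which a Fourier transform defines on the
generators. -/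
def preHom (F : FourierTransform c c') (t : ℂ) : PreAlg W h →ₐ[ℂ] RCA ρ' t c' :=
  FreeAlgebra.lift ℂ (Sum.elim (fun u => vec t c' (F.vecEquiv u))
    fun w => grp t c' (F.groupEquiv w))

theorem preHom_rel (F : FourierTransform c c') (t : ℂ) ⦃a b : PreAlg W h⦄ (hab : Rel ρ t c a b) :
    F.preHom t a = F.preHom t b := by
  induction hab with
  | add u v => simp [preHom, vec_add]
  | smul a u => simp [preHom, vec_smul]
  | one => simp [preHom, grp_one]
  | mul w w' => simp [preHom, grp_mul]
  | act w u => simp [preHom, grp_mul_vec, F.vecEquiv_doubled]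
  | comm u v =>
    rw [kappa, map_add, map_smul, map_one, map_finsum _ (Set.toFinite _)]
    simp only [preHom, map_sub, map_mul, map_smul, FreeAlgebra.lift_ι_apply, Sum.elim_inl,
      Sum.elim_inr, vec_mul_vec_sub, F.symp_vecEquiv]
    rw [← finsum_comp_equiv F.reflEquiv]
    congr 1
    refine finsum_congr fun s => ?_
    have h1 : ((F.reflEquiv s : {s : W' // IsReflection ρ' s}) : W') = F.groupEquiv s := rfl
    have h2 : c'.toFun (F.reflEquiv s) = c.toFun s := F.param_eq s s.2 _
    rw [h1, h2, F.reflForm_groupEquiv]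

/-- The homomorphism of Cherednik algebras given by a Fourier transform. -/
def hom (F : FourierTransform c c') (t : ℂ) : RCA ρ t c →ₐ[ℂ] RCA ρ' t c' :=
  RingQuot.liftAlgHom ℂ ⟨F.preHom t, F.preHom_rel t⟩

theorem hom_toRCA (F : FourierTransform c c') (t : ℂ) (a : PreAlg W h) :
    F.hom t (toRCA ρ t c a) = F.preHom t a :=
  RingQuot.liftAlgHom_mkAlgHom_apply ℂ _ (F.preHom_rel t) a

@[simp] theorem hom_vec (F : FourierTransform c c') (t : ℂ) (u : h × Module.Dual ℂ h) :
    F.hom t (vec t c u) = vec t c' (F.vecEquiv u) := by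
  rw [vec, hom_toRCA]; simp [preHom]

@[simp] theorem hom_grp (F : FourierTransform c c') (t : ℂ) (w : W) :
    F.hom t (grp t c w) = grp t c' (F.groupEquiv w) := by
  rw [grp, hom_toRCA]; simp [preHom]

theorem symm_hom_comp_hom (F : FourierTransform c c') (t : ℂ) :
    (F.symm.hom t).comp (F.hom t) = AlgHom.id ℂ _ := by
  refine RingQuot.ringQuot_ext' ℂ _ _ (FreeAlgebra.hom_ext (funext fun x => ?_))
  rcases x with u | w
  · exact (congrArg _ (F.hom_vec t u)).trans
      ((F.symm.hom_vec t _).trans (congrArg _ (F.vecEquiv.symm_apply_apply u)))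
  · exact (congrArg _ (F.hom_grp t w)).trans
      ((F.symm.hom_grp t _).trans (congrArg _ (F.groupEquiv.symm_apply_apply w)))

@[simp] theorem symm_hom_hom (F : FourierTransform c c') (t : ℂ) (a : RCA ρ t c) :
    F.symm.hom t (F.hom t a) = a :=
  DFunLike.congr_fun (F.symm_hom_comp_hom t) a

/-- The isomorphism of Cherednik algebras given by a Fourier transform. -/
def equiv (F : FourierTransform c c') (t : ℂ) : RCA ρ t c ≃ₐ[ℂ] RCA ρ' t c' :=
  AlgEquiv.ofAlgHom (F.hom t) (F.symm.hom t) (F.symm.symm_hom_comp_hom t) (F.symm_hom_comp_hom t)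

/-- A Fourier transform exchanges the generators of degrees `1` and `-1`, so it reverses degrees. -/
theorem isHomogeneous_hom (F : FourierTransform c c') {t : ℂ} {d : ℤ} {a : RCA ρ t c}
    (ha : IsHomogeneous t c d a) : IsHomogeneous t c' (-d) (F.hom t a) := by
  induction ha with
  | zero d => rw [map_zero]; exact .zero _
  | one => rw [map_one]; exact .one
  | ofGroup w => rw [hom_grp]; exact .ofGroup _
  | ofDual x =>
    rw [hom_vec, ← Prod.mk.eta (p := F.vecEquiv (0, x)), (F.snd_eq_zero_iff (0, x)).2 rfl]
    exact .ofVector _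
  | ofVector y =>
    rw [hom_vec, ← Prod.mk.eta (p := F.vecEquiv (y, 0)), (F.fst_eq_zero_iff (y, 0)).2 rfl]
    exact .ofDual _
  | add _ _ h1 h2 => rw [map_add]; exact .add h1 h2
  | smul r _ h1 => rw [map_smul]; exact .smul r h1
  | mul _ _ h1 h2 => rw [map_mul, neg_add]; exact .mul h1 h2

theorem isGeneric_of_isGeneric (F : FourierTransform c c') (hc : IsGeneric c) : IsGeneric c' := by
  have : IsRegularRing (Subalgebra.center ℂ (RCA ρ 0 c)) := hc
  let e : Subalgebra.center ℂ (RCA ρ 0 c) ≃+* Subalgebra.center ℂ (RCA ρ' 0 c') :=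
    Subring.centerCongr (F.equiv 0).toRingEquiv
  exact IsRegularRing.of_ringEquiv e

theorem isGeneric_iff (F : FourierTransform c c') : IsGeneric c ↔ IsGeneric c' :=
  ⟨F.isGeneric_of_isGeneric, F.symm.isGeneric_of_isGeneric⟩

/-! ### Restricted algebras -/

theorem hom_mem_dualPolyPlus (F : FourierTransform c c') {z : RCA ρ 0 c} (hz : z ∈ polyPlus c) :
    F.hom 0 z ∈ dualPolyPlus c' := by
  induction hz using NonUnitalAlgebra.adjoin_induction with
  | mem x hx =>
    obtain ⟨x, rfl⟩ := hx
    simp only [hom_vec]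
    rw [← Prod.mk.eta (p := F.vecEquiv (0, x)), (F.snd_eq_zero_iff (0, x)).2 rfl]
    exact NonUnitalAlgebra.subset_adjoin ℂ ⟨_, rfl⟩
  | add x y _ _ hx hy => rw [map_add]; exact add_mem hx hy
  | zero => rw [map_zero]; exact zero_mem _
  | mul x y _ _ hx hy => rw [map_mul]; exact mul_mem hx hy
  | smul r x _ hx => rw [map_smul]; exact SMulMemClass.smul_mem r hx

theorem hom_mem_polyPlus (F : FourierTransform c c') {z : RCA ρ 0 c} (hz : z ∈ dualPolyPlus c) :
    F.hom 0 z ∈ polyPlus c' := by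
  induction hz using NonUnitalAlgebra.adjoin_induction with
  | mem x hx =>
    obtain ⟨x, rfl⟩ := hx
    simp only [hom_vec]
    rw [← Prod.mk.eta (p := F.vecEquiv (x, 0)), (F.fst_eq_zero_iff (x, 0)).2 rfl]
    exact NonUnitalAlgebra.subset_adjoin ℂ ⟨_, rfl⟩
  | add x y _ _ hx hy => rw [map_add]; exact add_mem hx hy
  | zero => rw [map_zero]; exact zero_mem _
  | mul x y _ _ hx hy => rw [map_mul]; exact mul_mem hx hy
  | smul r x _ hx => rw [map_smul]; exact SMulMemClass.smul_mem r hx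

theorem hom_mem_rPlus (F : FourierTransform c c') {z : RCA ρ 0 c} (hz : z ∈ rPlus c) :
    F.hom 0 z ∈ rPlus c' := by
  refine ⟨hz.1.symm.imp F.hom_mem_polyPlus F.hom_mem_dualPolyPlus, fun w => ?_⟩
  obtain ⟨w, rfl⟩ := F.groupEquiv.surjective w
  rw [← hom_grp, ← map_mul, ← map_mul, hz.2]

theorem toRestricted_hom_rel (F : FourierTransform c c') ⦃a b : RCA ρ 0 c⦄
    (hab : RestrictedRel c a b) :
    (toRestricted c').comp (F.hom 0) a = (toRestricted c').comp (F.hom 0) b := by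
  obtain ⟨ha, rfl⟩ := hab
  rw [map_zero, AlgHom.comp_apply, ← map_zero (toRestricted c')]
  exact RingQuot.mkAlgHom_rel ℂ ⟨F.hom_mem_rPlus ha, rfl⟩

/-- The homomorphism of restricted Cherednik algebras given by a Fourier transform. -/
def restrictedHom (F : FourierTransform c c') : RestrictedRCA c →ₐ[ℂ] RestrictedRCA c' :=
  RingQuot.liftAlgHom ℂ ⟨(toRestricted c').comp (F.hom 0), F.toRestricted_hom_rel⟩

@[simp] theorem restrictedHom_toRestricted (F : FourierTransform c c') (a : RCA ρ 0 c) :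
    F.restrictedHom (toRestricted c a) = toRestricted c' (F.hom 0 a) :=
  RingQuot.liftAlgHom_mkAlgHom_apply ℂ _ F.toRestricted_hom_rel a

@[simp] theorem symm_restrictedHom_restrictedHom (F : FourierTransform c c')
    (a : RestrictedRCA c) : F.symm.restrictedHom (F.restrictedHom a) = a := by
  obtain ⟨a, rfl⟩ := RingQuot.mkAlgHom_surjective ℂ (RestrictedRel c) a
  change F.symm.restrictedHom (F.restrictedHom (toRestricted c a)) = toRestricted c a
  simp

/-- The isomorphism of restricted Cherednik algebras given by a Fourier transform. -/
def restrictedEquiv (F : FourierTransform c c') : RestrictedRCA c ≃ₐ[ℂ] RestrictedRCA c' where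
  __ := F.restrictedHom
  invFun := F.symm.restrictedHom
  left_inv := F.symm_restrictedHom_restrictedHom
  right_inv := F.symm.symm_restrictedHom_restrictedHom

/-! ### Induced modules -/

section Induced

variable {L L' : Type*} [AddCommGroup L] [Module ℂ L] [AddCommGroup L'] [Module ℂ L']

/-- The semilinear map `H̄_c ⊗ L → H̄_{c'} ⊗ L'` given by a Fourier transform and a linear map
`L → L'`. -/
def tensorMap (F : FourierTransform c c') (θ : L →ₗ[ℂ] L') :
    (RestrictedRCA c ⊗[ℂ] L) →ₛₗ[(F.restrictedHom : RestrictedRCA c →+* RestrictedRCA c')]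
      (RestrictedRCA c' ⊗[ℂ] L') where
  __ := (TensorProduct.map F.restrictedHom.toLinearMap θ).toAddMonoidHom
  map_smul' a m := by
    change TensorProduct.map F.restrictedHom.toLinearMap θ (a • m) =
      F.restrictedHom a • TensorProduct.map F.restrictedHom.toLinearMap θ m
    induction m with
    | zero => simp
    | tmul b v => simp [TensorProduct.smul_tmul']
    | add x y hx hy => simp only [smul_add, map_add, hx, hy]

@[simp] theorem tensorMap_tmul (F : FourierTransform c c') (θ : L →ₗ[ℂ] L') (a : RestrictedRCA c)
    (v : L) : F.tensorMap θ (a ⊗ₜ v) = F.restrictedHom a ⊗ₜ θ v := rfl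

variable [Module (MonoidAlgebra ℂ W) L] [Module (MonoidAlgebra ℂ W') L']

theorem vermaRel_le_comap (F : FourierTransform c c') (θ : L →ₗ[ℂ] L')
    (hθ : ∀ (w : W) (v : L), θ (MonoidAlgebra.of ℂ W w • v) =
      MonoidAlgebra.of ℂ W' (F.groupEquiv w) • θ v)
    {U : Set (h × Module.Dual ℂ h)} {U' : Set (h' × Module.Dual ℂ h')}
    (hU : ∀ u ∈ U, F.vecEquiv u ∈ U') :
    vermaRel c L U ≤ (vermaRel c' L' U').comap (F.tensorMap θ) := by
  refine Submodule.span_le.2 ?_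
  rintro _ (⟨a, w, v, rfl⟩ | ⟨a, u, v, hu, rfl⟩) <;>
    refine Submodule.subset_span ?_
  · refine Or.inl ⟨F.restrictedHom a, F.groupEquiv w, θ v, ?_⟩
    rw [map_sub, tensorMap_tmul, tensorMap_tmul, map_mul, restrictedHom_toRestricted, hom_grp, hθ]
  · refine Or.inr ⟨F.restrictedHom a, F.vecEquiv u, θ v, hU u hu, ?_⟩
    rw [tensorMap_tmul, map_mul, restrictedHom_toRestricted, hom_vec]

/-- A Fourier transform and a linear map `L → L'` compatible with `W ≃ W'` give a semilinear map
of induced modules. -/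
def inducedMap (F : FourierTransform c c') (θ : L →ₗ[ℂ] L')
    (hθ : ∀ (w : W) (v : L), θ (MonoidAlgebra.of ℂ W w • v) =
      MonoidAlgebra.of ℂ W' (F.groupEquiv w) • θ v)
    {U : Set (h × Module.Dual ℂ h)} {U' : Set (h' × Module.Dual ℂ h')}
    (hU : ∀ u ∈ U, F.vecEquiv u ∈ U') :
    Induced c L U →ₛₗ[(F.restrictedHom : RestrictedRCA c →+* RestrictedRCA c')]
      Induced c' L' U' :=
  Submodule.mapQ _ _ (F.tensorMap θ) (F.vermaRel_le_comap θ hθ hU)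

variable (F : FourierTransform c c') (θ : L ≃ₗ[ℂ] L')
    (hθ : ∀ (w : W) (v : L), θ (MonoidAlgebra.of ℂ W w • v) =
      MonoidAlgebra.of ℂ W' (F.groupEquiv w) • θ v)
    {U : Set (h × Module.Dual ℂ h)} {U' : Set (h' × Module.Dual ℂ h')}
    (hU : ∀ u, F.vecEquiv u ∈ U' ↔ u ∈ U)

theorem symm_inducedMap_inducedMap (m : Induced c L U) :
    F.symm.inducedMap θ.symm.toLinearMap (F.symm_of_smul θ hθ)
      (fun u => (F.symm_mem_iff hU u).2)
      (F.inducedMap θ.toLinearMap hθ (fun u => (hU u).2) m) = m := by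
  obtain ⟨m, rfl⟩ := Submodule.mkQ_surjective _ m
  change (vermaRel c L U).mkQ (F.symm.tensorMap θ.symm.toLinearMap
    (F.tensorMap θ.toLinearMap m)) = _
  congr 1
  induction m with
  | zero => simp
  | tmul a v => simp
  | add x y hx hy => simp only [map_add, hx, hy]

/-- The isomorphism of induced modules, semilinear over `restrictedEquiv`. It is recorded as an
additive isomorphism; `inducedEquiv_smul` is the semilinearity. -/
def inducedEquiv : Induced c L U ≃+ Induced c' L' U' where
  __ := (F.inducedMap θ.toLinearMap hθ (fun u => (hU u).2)).toAddMonoidHom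
  invFun := F.symm.inducedMap θ.symm.toLinearMap (F.symm_of_smul θ hθ)
      (fun u => (F.symm_mem_iff hU u).2)
  left_inv := F.symm_inducedMap_inducedMap θ hθ hU
  right_inv := F.symm.symm_inducedMap_inducedMap θ.symm (F.symm_of_smul θ hθ) (F.symm_mem_iff hU)

theorem inducedEquiv_smul (a : RestrictedRCA c) (m : Induced c L U) :
    F.inducedEquiv θ hθ hU (a • m) = F.restrictedEquiv a • F.inducedEquiv θ hθ hU m :=
  map_smulₛₗ (F.inducedMap θ.toLinearMap hθ (fun u => (hU u).2)) a m

theorem inducedEquiv_mem_inducedDeg {d : ℤ} {m : Induced c L U} (hm : m ∈ inducedDeg c L U d) :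
    F.inducedEquiv θ hθ hU m ∈ inducedDeg c' L' U' (-d) := by
  induction hm using Submodule.span_induction with
  | mem x hx =>
    obtain ⟨a, v, ha, rfl⟩ := hx
    refine Submodule.subset_span ⟨F.hom 0 a, θ v, F.isHomogeneous_hom ha, ?_⟩
    rw [← restrictedHom_toRestricted]
    rfl
  | zero => rw [map_zero]; exact zero_mem _
  | add x y _ _ hx hy => rw [map_add]; exact add_mem hx hy
  | smul r x _ hx =>
    rw [← algebraMap_smul (RestrictedRCA c) r x, inducedEquiv_smul, AlgEquiv.commutes,
      algebraMap_smul]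
    exact Submodule.smul_mem _ r hx

end Induced

end FourierTransform

/-! ### Endomorphism algebras under semilinear isomorphisms -/

/-- Conjugation by an isomorphism of modules semilinear over `e : A ≃ B`. -/
def endCongr {A B M N : Type*} [Ring A] [Ring B] [Algebra ℂ A] [Algebra ℂ B] [AddCommGroup M]
    [AddCommGroup N] [Module A M] [Module B N] [Module ℂ M] [Module ℂ N] [IsScalarTower ℂ A M]
    [IsScalarTower ℂ B N] (e : A ≃ₐ[ℂ] B) (E : M ≃+ N)
    (hE : ∀ (a : A) (m : M), E (a • m) = e a • E m) : Module.End A M ≃ₐ[ℂ] Module.End B N where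
  toFun f :=
    { toFun := fun x => E (f (E.symm x))
      map_add' := fun x y => by simp
      map_smul' := fun b x => by
        have h1 : E.symm (b • x) = e.symm b • E.symm x := by
          rw [AddEquiv.symm_apply_eq, hE]; simp
        simp [h1, hE] }
  invFun g :=
    { toFun := fun x => E.symm (g (E x))
      map_add' := fun x y => by simp
      map_smul' := fun a x => by
        rw [hE, map_smul, AddEquiv.symm_apply_eq, RingHom.id_apply, hE, AddEquiv.apply_symm_apply] }
  left_inv f := by ext; simp
  right_inv g := by ext; simp
  map_mul' f g := by ext; simp
  map_add' f g := by ext; simp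
  commutes' r := by
    ext x
    change E (r • E.symm x) = r • x
    rw [← algebraMap_smul A r (E.symm x), hE, AlgEquiv.commutes, algebraMap_smul,
      AddEquiv.apply_symm_apply]

namespace FourierTransform

variable {W h W' h' : Type*} [Group W] [AddCommGroup h] [Module ℂ h]
    [Group W'] [AddCommGroup h'] [Module ℂ h'] {ρ : Representation ℂ W h}
    {ρ' : Representation ℂ W' h'} {c : ReflParam ρ} {c' : ReflParam ρ'} [Finite W] [Finite W']
  {L L' : Type*} [AddCommGroup L] [Module ℂ L] [Module (MonoidAlgebra ℂ W) L]
  [AddCommGroup L'] [Module ℂ L'] [Module (MonoidAlgebra ℂ W') L']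
  (F : FourierTransform c c') (θ : L ≃ₗ[ℂ] L')
    (hθ : ∀ (w : W) (v : L), θ (MonoidAlgebra.of ℂ W w • v) =
      MonoidAlgebra.of ℂ W' (F.groupEquiv w) • θ v)
    {U : Set (h × Module.Dual ℂ h)} {U' : Set (h' × Module.Dual ℂ h')}
    (hU : ∀ u, F.vecEquiv u ∈ U' ↔ u ∈ U)

/-- The isomorphism between the endomorphism algebras of induced modules; it reverses degrees by
`isHomogeneousEnd_iff`. -/
def endEquiv : Module.End (RestrictedRCA c) (Induced c L U) ≃ₐ[ℂ]
    Module.End (RestrictedRCA c') (Induced c' L' U') :=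
  endCongr F.restrictedEquiv (F.inducedEquiv θ hθ hU) (F.inducedEquiv_smul θ hθ hU)

theorem isHomogeneousEnd_endEquiv {d : ℤ} {f : Module.End (RestrictedRCA c) (Induced c L U)}
    (hf : IsHomogeneousEnd c L U d f) :
    IsHomogeneousEnd c' L' U' (-d) (F.endEquiv θ hθ hU f) := by
  intro k m hm
  have h1 : (F.inducedEquiv θ hθ hU).symm m ∈ inducedDeg c L U (-k) :=
    F.symm.inducedEquiv_mem_inducedDeg θ.symm (F.symm_of_smul θ hθ) (F.symm_mem_iff hU) hm
  have h2 := F.inducedEquiv_mem_inducedDeg θ hθ hU (hf _ _ h1)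
  rw [neg_add, neg_neg] at h2
  exact h2

theorem isHomogeneousEnd_iff (d : ℤ) (f : Module.End (RestrictedRCA c) (Induced c L U)) :
    IsHomogeneousEnd c L U d f ↔
      IsHomogeneousEnd c' L' U' (-d) (F.endEquiv θ hθ hU f) := by
  refine ⟨F.isHomogeneousEnd_endEquiv θ hθ hU, fun hf => ?_⟩
  have h1 := F.symm.isHomogeneousEnd_endEquiv θ.symm (F.symm_of_smul θ hθ) (F.symm_mem_iff hU) hf
  rw [neg_neg] at h1
  exact (F.endEquiv θ hθ hU).symm_apply_apply f ▸ h1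

end FourierTransform

/-! ### The Fourier transform for the wreath product -/

section Wreath

variable {ℓ n : ℕ}

theorem Wreath.ext {w w' : Wreath ℓ n} (hl : ∀ j, w.left j = w'.left j)
    (hr : w.right = w'.right) : w = w' :=
  SemidirectProduct.ext (funext hl) hr

theorem Wreath.mul_left_apply (w w' : Wreath ℓ n) (j : Fin n) :
    (w * w').left j = w.left j * w'.left (w.right⁻¹ j) := rfl

/-- The automorphism of `S_n ≀ ℤ/ℓℤ` which sends `γ_i` to `γ_i⁻¹` and is trivial on `S_n`. -/
def Wreath.flip (ℓ n : ℕ) : Wreath ℓ n ≃* Wreath ℓ n where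
  toFun w := ⟨w.left⁻¹, w.right⟩
  invFun w := ⟨w.left⁻¹, w.right⟩
  left_inv _ := Wreath.ext (fun _ => inv_inv _) rfl
  right_inv _ := Wreath.ext (fun _ => inv_inv _) rfl
  map_mul' _ _ := Wreath.ext (fun _ => mul_inv _ _) rfl

theorem Wreath.flip_left (w : Wreath ℓ n) : (Wreath.flip ℓ n w).left = w.left⁻¹ := rfl

@[simp] theorem Wreath.flip_right (w : Wreath ℓ n) : (Wreath.flip ℓ n w).right = w.right := rfl

theorem Wreath.flip_flip (w : Wreath ℓ n) : Wreath.flip ℓ n (Wreath.flip ℓ n w) = w :=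
  (Wreath.flip ℓ n).left_inv w

variable [NeZero ℓ] {ω : ℂ}

theorem wreathRep_apply (hω : IsPrimitiveRoot ω ℓ) (w : Wreath ℓ n) (v : Fin n → ℂ) (j : Fin n) :
    wreathRep n hω w v j = cyclicChar hω (w.left j) * v (w.right⁻¹ j) := rfl

theorem eq_one_of_cyclicChar_eq_one (hω : IsPrimitiveRoot ω ℓ) {a : Multiplicative (ZMod ℓ)}
    (ha : cyclicChar hω a = 1) : a = 1 := by
  have h1 : ω ^ (Multiplicative.toAdd a).val = 1 := ha
  have h2 := Nat.eq_zero_of_dvd_of_lt (hω.dvd_of_pow_eq_one _ h1) (ZMod.val_lt _)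
  exact (ZMod.val_eq_zero _).1 h2

theorem cyclicChar_inv_mul (hω : IsPrimitiveRoot ω ℓ) (a : Multiplicative (ZMod ℓ)) :
    cyclicChar hω a⁻¹ * cyclicChar hω a = 1 := by
  rw [← map_mul, inv_mul_cancel, map_one]

theorem wreathRep_dotProduct (hω : IsPrimitiveRoot ω ℓ) (w : Wreath ℓ n) (y z : Fin n → ℂ) :
    wreathRep n hω w y ⬝ᵥ wreathRep n hω (Wreath.flip ℓ n w) z = y ⬝ᵥ z := by
  rw [dotProduct, dotProduct, ← Equiv.sum_comp w.right⁻¹ fun j => y j * z j]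
  refine Finset.sum_congr rfl fun j _ => ?_
  rw [wreathRep_apply, wreathRep_apply, Wreath.flip_right, Wreath.flip_left, Pi.inv_apply]
  linear_combination (y (w.right⁻¹ j) * z (w.right⁻¹ j)) * cyclicChar_inv_mul hω (w.left j)

/-- The identification `𝔥 ≃ 𝔥*` of the standard basis with its dual basis turns `𝔥` into the twist
of `𝔥*` by `Wreath.flip`. -/
theorem dotProductEquiv_wreathRep (hω : IsPrimitiveRoot ω ℓ) (w : Wreath ℓ n) (y : Fin n → ℂ) :
    dotProductEquiv ℂ (Fin n) (wreathRep n hω w y) =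
      (wreathRep n hω).dual (Wreath.flip ℓ n w) (dotProductEquiv ℂ (Fin n) y) := by
  refine LinearMap.ext fun z => ?_
  change wreathRep n hω w y ⬝ᵥ z = y ⬝ᵥ wreathRep n hω (Wreath.flip ℓ n w)⁻¹ z
  rw [← wreathRep_dotProduct hω w y, ← Module.End.mul_apply, ← map_mul, mul_inv_cancel, map_one,
    Module.End.one_apply]

theorem dotProductEquiv_symm_dual (hω : IsPrimitiveRoot ω ℓ) (w : Wreath ℓ n)
    (x : Module.Dual ℂ (Fin n → ℂ)) :
    (dotProductEquiv ℂ (Fin n)).symm ((wreathRep n hω).dual w x) =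
      wreathRep n hω (Wreath.flip ℓ n w) ((dotProductEquiv ℂ (Fin n)).symm x) := by
  rw [LinearEquiv.symm_apply_eq, dotProductEquiv_wreathRep, Wreath.flip_flip,
    LinearEquiv.apply_symm_apply]

/-- The symplectic automorphism `(y, x) ↦ (-φ⁻¹ x, φ y)` of `𝔥 ⊕ 𝔥*`, where `φ : 𝔥 ≃ 𝔥*` sends the
standard basis to its dual basis. -/
def wreathVecEquiv (n : ℕ) :
    ((Fin n → ℂ) × Module.Dual ℂ (Fin n → ℂ)) ≃ₗ[ℂ] ((Fin n → ℂ) × Module.Dual ℂ (Fin n → ℂ)) where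
  toFun u := (-(dotProductEquiv ℂ (Fin n)).symm u.2, dotProductEquiv ℂ (Fin n) u.1)
  invFun u := ((dotProductEquiv ℂ (Fin n)).symm u.2, -dotProductEquiv ℂ (Fin n) u.1)
  map_add' u v := by ext <;> simp [add_comm]
  map_smul' a u := by ext <;> simp
  left_inv u := by simp
  right_inv u := by simp

theorem wreathVecEquiv_apply (u : (Fin n → ℂ) × Module.Dual ℂ (Fin n → ℂ)) :
    wreathVecEquiv n u = (-(dotProductEquiv ℂ (Fin n)).symm u.2, dotProductEquiv ℂ (Fin n) u.1) :=
  rfl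

theorem apply_eq_dotProductEquiv_symm (x : Module.Dual ℂ (Fin n → ℂ)) (y : Fin n → ℂ) :
    dotProductEquiv ℂ (Fin n) y ((dotProductEquiv ℂ (Fin n)).symm x) = x y := by
  obtain ⟨z, rfl⟩ := (dotProductEquiv ℂ (Fin n)).surjective x
  rw [LinearEquiv.symm_apply_apply]
  exact dotProduct_comm y z

theorem symp_wreathVecEquiv (u v : (Fin n → ℂ) × Module.Dual ℂ (Fin n → ℂ)) :
    symp (wreathVecEquiv n u) (wreathVecEquiv n v) = symp u v := by
  simp only [symp, wreathVecEquiv_apply, map_neg, apply_eq_dotProductEquiv_symm]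
  ring

theorem wreathVecEquiv_doubled (hω : IsPrimitiveRoot ω ℓ) (w : Wreath ℓ n)
    (u : (Fin n → ℂ) × Module.Dual ℂ (Fin n → ℂ)) :
    wreathVecEquiv n (doubled (wreathRep n hω) w u) =
      doubled (wreathRep n hω) (Wreath.flip ℓ n w) (wreathVecEquiv n u) := by
  change (-(dotProductEquiv ℂ (Fin n)).symm ((wreathRep n hω).dual w u.2),
    dotProductEquiv ℂ (Fin n) (wreathRep n hω w u.1)) =
    (wreathRep n hω (Wreath.flip ℓ n w) (-(dotProductEquiv ℂ (Fin n)).symm u.2),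
      (wreathRep n hω).dual (Wreath.flip ℓ n w) (dotProductEquiv ℂ (Fin n) u.1))
  rw [dotProductEquiv_symm_dual, dotProductEquiv_wreathRep, map_neg]

/-- `1 - ρ(flip s)` is conjugate to the transpose of `1 - ρ(s⁻¹)`. -/
theorem isReflection_flip (hω : IsPrimitiveRoot ω ℓ) {s : Wreath ℓ n}
    (hs : IsReflection (wreathRep n hω) s) :
    IsReflection (wreathRep n hω) (Wreath.flip ℓ n s) := by
  have h1 : (dotProductEquiv ℂ (Fin n)).toLinearMap ∘ₗ (1 - wreathRep n hω (Wreath.flip ℓ n s)) =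
      (1 - wreathRep n hω s⁻¹).dualMap ∘ₗ (dotProductEquiv ℂ (Fin n)).toLinearMap := by
    refine LinearMap.ext fun y => LinearMap.ext fun z => ?_
    have h2 := DFunLike.congr_fun (dotProductEquiv_wreathRep hω (Wreath.flip ℓ n s) y) z
    rw [Wreath.flip_flip] at h2
    change dotProductEquiv ℂ (Fin n) (y - wreathRep n hω (Wreath.flip ℓ n s) y) z =
      dotProductEquiv ℂ (Fin n) y (z - wreathRep n hω s⁻¹ z)
    rw [map_sub, LinearMap.sub_apply, h2, map_sub]
    rfl
  have h3 := congrArg (fun f => Module.finrank ℂ (LinearMap.range f)) h1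
  rw [LinearMap.range_comp, LinearEquiv.finrank_map_eq,
    LinearMap.range_comp_of_range_eq_top _ (LinearEquiv.range _),
    LinearMap.finrank_range_dualMap_eq_finrank_range] at h3
  exact h3.trans (isReflection_inv _ hs)

/-- A reflection with nontrivial image in `S_n` is some `σ_{ij} γ_i^k γ_j^{-k}`; conjugation by
`σ_{ij}` inverts `k`. -/
theorem isConj_flip (hω : IsPrimitiveRoot ω ℓ) {s : Wreath ℓ n}
    (hs : IsReflection (wreathRep n hω) s) (h1 : s.right ≠ 1) :
    IsConj s (Wreath.flip ℓ n s) := by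
  obtain ⟨i, hi⟩ : ∃ i, s.right⁻¹ i ≠ i := by
    by_contra! h
    exact h1 (inv_eq_one.1 (Equiv.ext h))
  set τ := s.right⁻¹ with hτ
  set j := s.right i with hj
  have hτj : τ j = i := by simp [hτ, hj]
  have hij : j ≠ i := fun h => hi (by rwa [h] at hτj)
  set D := 1 - wreathRep n hω s with hD
  have hval (k m : Fin n) : D (Pi.single k 1) m = (if m = k then 1 else 0) -
      cyclicChar hω (s.left m) * (if τ m = k then 1 else 0) := by
    rw [hD, LinearMap.sub_apply, Pi.sub_apply, wreathRep_apply, Module.End.one_apply,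
      Pi.single_apply, Pi.single_apply]
  -- All columns of `1 - s` are multiples of the column `i`, whose entry in the row `i` is `1`.
  have key (k m : Fin n) :
      D (Pi.single k 1) m = D (Pi.single k 1) i * D (Pi.single i 1) m := by
    have hne : (⟨D (Pi.single i 1), LinearMap.mem_range_self D _⟩ : LinearMap.range D) ≠ 0 := by
      intro h
      have h2 : D (Pi.single i 1) i = 0 := congrFun (congrArg Subtype.val h) i
      rw [hval, if_pos rfl, if_neg hi] at h2
      simp at h2
    obtain ⟨a, ha⟩ := (finrank_eq_one_iff_of_nonzero' _ hne).1 hs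
      ⟨D (Pi.single k 1), LinearMap.mem_range_self D _⟩
    have ha' (m : Fin n) : a * D (Pi.single i 1) m = D (Pi.single k 1) m :=
      congrFun (congrArg Subtype.val ha) m
    have h2 := ha' i
    rw [hval i i, if_pos rfl, if_neg hi, mul_zero, sub_zero, mul_one] at h2
    rw [← ha', h2]
  -- Row `j` of column `j` forces `σ j = i`, and then that the entries at `i` and `j` are inverse.
  have hjj := key j j
  simp only [hval, hτj, if_true, if_neg hij, if_neg hij.symm] at hjj
  have hτi : τ i = j := by
    by_contra h
    simp [h] at hjj
  have hprod : s.left i * s.left j = 1 := by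
    refine eq_one_of_cyclicChar_eq_one hω ?_
    rw [map_mul]
    simp only [hτi, if_true] at hjj
    linear_combination -hjj
  have hother (k : Fin n) (hki : k ≠ i) (hkj : k ≠ j) : τ k = k ∧ s.left k = 1 := by
    have hkk := key k k
    simp only [hval, hτi, if_true, if_neg hki.symm, if_neg hkj.symm, mul_zero, sub_zero,
      zero_mul] at hkk
    have hk : τ k = k := by
      by_contra h
      simp [h] at hkk
    refine ⟨hk, eq_one_of_cyclicChar_eq_one hω ?_⟩
    rw [if_pos hk] at hkk
    linear_combination -hkk
  refine isConj_iff.2 ⟨SemidirectProduct.inr s.right, mul_inv_eq_iff_eq_mul.2 ?_⟩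
  refine Wreath.ext (fun m => ?_) rfl
  rw [Wreath.mul_left_apply, Wreath.mul_left_apply, SemidirectProduct.left_inr,
    SemidirectProduct.right_inr, ← hτ, Wreath.flip_left, Pi.one_apply, Pi.one_apply, one_mul,
    mul_one, Pi.inv_apply]
  by_cases hmi : m = i
  · rw [hmi, hτi]
    exact eq_inv_of_mul_eq_one_right hprod
  by_cases hmj : m = j
  · rw [hmj, hτj]
    exact eq_inv_of_mul_eq_one_left hprod
  · obtain ⟨h2, h3⟩ := hother m hmi hmj
    rw [h2, h3, inv_one]

theorem barParam_eq {hω : IsPrimitiveRoot ω ℓ} (c : ReflParam (wreathRep n hω)) (s : Wreath ℓ n)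
    (hs : IsReflection (wreathRep n hω) s)
    (hs' : IsReflection (wreathRep n hω) (Wreath.flip ℓ n s)) :
    c.toFun ⟨Wreath.flip ℓ n s, hs'⟩ = (barParam c).toFun ⟨s, hs⟩ := by
  by_cases h1 : s.right = 1
  · change _ = if s.right = 1 then c.toFun ⟨s⁻¹, isReflection_inv _ hs⟩ else c.toFun ⟨s, hs⟩
    rw [if_pos h1]
    congr 2
    refine Wreath.ext (fun j => ?_) ?_
    · rw [SemidirectProduct.inv_left, h1]; rfl
    · rw [SemidirectProduct.inv_right, h1]; exact h1
  · change _ = if s.right = 1 then c.toFun ⟨s⁻¹, isReflection_inv _ hs⟩ else c.toFun ⟨s, hs⟩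
    rw [if_neg h1]
    exact (c.map_conj _ _ (isConj_flip hω hs h1)).symm

/-- The Fourier transform from the parameter `c̄` to the parameter `c`. -/
def wreathFourier {hω : IsPrimitiveRoot ω ℓ} (c : ReflParam (wreathRep n hω)) :
    FourierTransform (barParam c) c where
  groupEquiv := Wreath.flip ℓ n
  vecEquiv := wreathVecEquiv n
  vecEquiv_doubled := wreathVecEquiv_doubled hω
  symp_vecEquiv := symp_wreathVecEquiv
  isReflection_iff s := ⟨fun hs => Wreath.flip_flip s ▸ isReflection_flip hω hs,
    isReflection_flip hω⟩
  param_eq := barParam_eq c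
  snd_eq_zero_iff _ := (dotProductEquiv ℂ (Fin n)).map_eq_zero_iff
  fst_eq_zero_iff _ := neg_eq_zero.trans (dotProductEquiv ℂ (Fin n)).symm.map_eq_zero_iff

end Wreath

/-! ### The irreducible modules under the flip -/

variable {ℓ n : ℕ} {ω : ℂ}

namespace Multipartition

/-- The cells of `μ*` are the cells of `μ`, the component `i` being relabelled as `-i`. -/
def starCellEquiv (μ : Multipartition ℓ n) : μ.star.Cell ≃ μ.Cell where
  toFun x := ⟨-x.1, x.2⟩
  invFun x := ⟨-x.1, ⟨x.2.1, by
    change x.2.1 ∈ (μ.parts (- -x.1)).cells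
    rw [neg_neg]
    exact x.2.2⟩⟩
  left_inv x := by
    refine Sigma.ext (neg_neg _) ?_
    refine (Subtype.heq_iff_coe_eq fun y => ?_).2 rfl
    simp only [neg_neg]
  right_inv x := by
    refine Sigma.ext (neg_neg _) ?_
    refine (Subtype.heq_iff_coe_eq fun y => ?_).2 rfl
    simp only [neg_neg]

/-- The permutation comparing the chosen tableaux of `μ*` and of `μ`. -/
def starPerm (μ : Multipartition ℓ n) : Equiv.Perm (Fin n) :=
  (μ.star.tableau.symm.trans μ.starCellEquiv).trans μ.tableau

theorem tableau_symm_starPerm (μ : Multipartition ℓ n) (k : Fin n) :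
    μ.tableau.symm (μ.starPerm k) = μ.starCellEquiv (μ.star.tableau.symm k) := by
  simp [starPerm]

theorem comp_starPerm (μ : Multipartition ℓ n) (k : Fin n) :
    μ.comp (μ.starPerm k) = -μ.star.comp k := by
  rw [comp, tableau_symm_starPerm]; rfl

theorem row_starPerm (μ : Multipartition ℓ n) (k : Fin n) :
    μ.row (μ.starPerm k) = μ.star.row k := by
  rw [row, tableau_symm_starPerm]; rfl

theorem col_starPerm (μ : Multipartition ℓ n) (k : Fin n) :
    μ.col (μ.starPerm k) = μ.star.col k := by
  rw [col, tableau_symm_starPerm]; rfl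

end Multipartition

/-- The automorphism of the group algebra induced by `Wreath.flip`. -/
def flipAlg (ℓ n : ℕ) : MonoidAlgebra ℂ (Wreath ℓ n) ≃ₐ[ℂ] MonoidAlgebra ℂ (Wreath ℓ n) :=
  MonoidAlgebra.domCongr ℂ ℂ (Wreath.flip ℓ n)

@[simp] theorem flipAlg_of (w : Wreath ℓ n) : flipAlg ℓ n (MonoidAlgebra.of ℂ (Wreath ℓ n) w) =
    MonoidAlgebra.of ℂ (Wreath ℓ n) (Wreath.flip ℓ n w) :=
  MonoidAlgebra.domCongr_single _ _ _

/-- The element of the group algebra given by `starPerm`. -/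
def starUnit (μ : Multipartition ℓ n) : MonoidAlgebra ℂ (Wreath ℓ n) :=
  MonoidAlgebra.of ℂ (Wreath ℓ n) (SemidirectProduct.inr μ.starPerm)

/-- The inverse of `starUnit`. -/
def starUnitInv (μ : Multipartition ℓ n) : MonoidAlgebra ℂ (Wreath ℓ n) :=
  MonoidAlgebra.of ℂ (Wreath ℓ n) (SemidirectProduct.inr μ.starPerm)⁻¹

@[simp] theorem starUnit_mul_starUnitInv (μ : Multipartition ℓ n) :
    starUnit μ * starUnitInv μ = 1 := by
  rw [starUnit, starUnitInv, ← map_mul, mul_inv_cancel, map_one]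

@[simp] theorem starUnitInv_mul_starUnit (μ : Multipartition ℓ n) :
    starUnitInv μ * starUnit μ = 1 := by
  rw [starUnit, starUnitInv, ← map_mul, inv_mul_cancel, map_one]

theorem flip_inr (σ : Equiv.Perm (Fin n)) :
    Wreath.flip ℓ n (SemidirectProduct.inr σ) = SemidirectProduct.inr σ :=
  Wreath.ext (fun _ => inv_one) rfl

theorem starUnit_mul_inr (μ : Multipartition ℓ n) (σ : Equiv.Perm (Fin n)) :
    starUnit μ * MonoidAlgebra.of ℂ (Wreath ℓ n) (SemidirectProduct.inr σ) =
      MonoidAlgebra.of ℂ (Wreath ℓ n) (SemidirectProduct.inr (MulAut.conj μ.starPerm σ)) *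
        starUnit μ := by
  rw [starUnit, ← map_mul, ← map_mul, ← map_mul, ← map_mul, MulAut.conj_apply,
    inv_mul_cancel_right]

theorem starUnit_mul_rowSym (μ : Multipartition ℓ n) :
    starUnit μ * flipAlg ℓ n μ.star.rowSym = μ.rowSym * starUnit μ := by
  rw [Multipartition.rowSym, Multipartition.rowSym, map_sum, Finset.mul_sum, Finset.sum_mul]
  refine Finset.sum_equiv (MulAut.conj μ.starPerm).toEquiv (fun σ => ?_) fun σ _ => ?_
  · simp only [Finset.mem_filter, Finset.mem_univ, true_and]
    rw [← μ.starPerm.forall_congr_right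
      (q := fun k => μ.comp (((MulAut.conj μ.starPerm).toEquiv σ) k) = μ.comp k ∧
        μ.row (((MulAut.conj μ.starPerm).toEquiv σ) k) = μ.row k)]
    simp [μ.comp_starPerm, μ.row_starPerm]
  · rw [flipAlg_of, flip_inr]
    exact starUnit_mul_inr μ σ

theorem starUnit_mul_colSym (μ : Multipartition ℓ n) :
    starUnit μ * flipAlg ℓ n μ.star.colSym = μ.colSym * starUnit μ := by
  rw [Multipartition.colSym, Multipartition.colSym, map_sum, Finset.mul_sum, Finset.sum_mul]
  refine Finset.sum_equiv (MulAut.conj μ.starPerm).toEquiv (fun σ => ?_) fun σ _ => ?_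
  · simp only [Finset.mem_filter, Finset.mem_univ, true_and]
    rw [← μ.starPerm.forall_congr_right
      (q := fun k => μ.comp (((MulAut.conj μ.starPerm).toEquiv σ) k) = μ.comp k ∧
        μ.col (((MulAut.conj μ.starPerm).toEquiv σ) k) = μ.col k)]
    simp [μ.comp_starPerm, μ.col_starPerm]
  · have hsign : Equiv.Perm.sign (MulAut.conj μ.starPerm σ) = Equiv.Perm.sign σ := by
      rw [MulAut.conj_apply, map_mul, map_mul, map_inv, mul_right_comm, mul_inv_cancel, one_mul]
    rw [map_smul, flipAlg_of, flip_inr, mul_smul_comm, smul_mul_assoc, starUnit_mul_inr,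
      ← hsign]
    rfl

/-- The linear map `x ↦ flip(x) π⁻¹` of the group algebra, where `π` compares the tableaux of `μ*`
and of `μ`. -/
def flipMulEquiv (μ : Multipartition ℓ n) :
    MonoidAlgebra ℂ (Wreath ℓ n) ≃ₗ[ℂ] MonoidAlgebra ℂ (Wreath ℓ n) where
  toFun x := flipAlg ℓ n x * starUnitInv μ
  invFun y := (flipAlg ℓ n).symm (y * starUnit μ)
  map_add' x y := by rw [map_add, add_mul]
  map_smul' a x := by rw [map_smul, smul_mul_assoc, RingHom.id_apply]
  left_inv x := by simp [mul_assoc]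
  right_inv x := by simp [mul_assoc]

theorem flipMulEquiv_apply (μ : Multipartition ℓ n) (x : MonoidAlgebra ℂ (Wreath ℓ n)) :
    flipMulEquiv μ x = flipAlg ℓ n x * starUnitInv μ := rfl

variable [NeZero ℓ]

theorem cyclicChar_pow_card (hω : IsPrimitiveRoot ω ℓ) (a : Multiplicative (ZMod ℓ)) :
    cyclicChar hω a ^ ℓ = 1 := by
  rw [← map_pow, ← map_one (cyclicChar hω)]
  congr 1
  apply Multiplicative.toAdd.injective
  simp

/-- The character `γ ↦ ω^(-i)` evaluated at `γ⁻¹` is the character `γ ↦ ω^i` evaluated at `γ`. -/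
theorem cyclicChar_inv_pow_neg (hω : IsPrimitiveRoot ω ℓ) (a : Multiplicative (ZMod ℓ))
    (i : Fin ℓ) : cyclicChar hω a⁻¹ ^ ((-i : Fin ℓ) : ℕ) = cyclicChar hω a ^ (i : ℕ) := by
  have h1 := cyclicChar_inv_mul hω a
  have h2 : cyclicChar hω a⁻¹ ^ (i : ℕ) * cyclicChar hω a ^ (i : ℕ) = 1 := by
    rw [← mul_pow, h1, one_pow]
  have h3 : cyclicChar hω a⁻¹ ^ (i : ℕ) * cyclicChar hω a⁻¹ ^ ((-i : Fin ℓ) : ℕ) = 1 := by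
    rw [← pow_add]
    obtain ⟨m, hm⟩ : ℓ ∣ (i : ℕ) + ((-i : Fin ℓ) : ℕ) := by
      have h4 : ((i + -i : Fin ℓ) : ℕ) = 0 := by rw [add_neg_cancel]; rfl
      rw [Fin.val_add] at h4
      exact Nat.dvd_of_mod_eq_zero h4
    rw [hm, pow_mul, cyclicChar_pow_card, one_pow]
  exact mul_left_cancel₀ (left_ne_zero_of_mul_eq_one h2) (h3.trans h2.symm)

theorem starUnit_mul_charSym (hω : IsPrimitiveRoot ω ℓ) (μ : Multipartition ℓ n) :
    starUnit μ * flipAlg ℓ n (μ.star.charSym hω) = μ.charSym hω * starUnit μ := by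
  rw [Multipartition.charSym, Multipartition.charSym, map_sum, Finset.mul_sum, Finset.sum_mul]
  refine Fintype.sum_equiv ((Equiv.inv _).trans (Equiv.arrowCongr μ.starPerm (Equiv.refl _)))
    _ _ fun f => ?_
  rw [map_smul, flipAlg_of, mul_smul_comm, smul_mul_assoc]
  congr 1
  · congr 1
    rw [← Equiv.prod_comp μ.starPerm
      (fun k => cyclicChar hω (((Equiv.inv _).trans
        (Equiv.arrowCongr μ.starPerm (Equiv.refl _))) f k) ^ (μ.comp k : ℕ))]
    refine Finset.prod_congr rfl fun k _ => ?_
    rw [μ.comp_starPerm, ← cyclicChar_inv_pow_neg]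
    simp
  · rw [starUnit, ← map_mul, ← map_mul]
    congr 1
    refine Wreath.ext (fun j => ?_) ?_
    · rw [Wreath.mul_left_apply, Wreath.mul_left_apply]
      simp [Wreath.flip_left]
    · simp

/-- The element generating `Irrep`: the product of the idempotent of a character of `(ℤ/ℓℤ)ⁿ` and a
Young symmetrizer. -/
def irrepGen (hω : IsPrimitiveRoot ω ℓ) (μ : Multipartition ℓ n) :
    MonoidAlgebra ℂ (Wreath ℓ n) :=
  μ.charSym hω * (μ.rowSym * μ.colSym)

theorem starUnit_mul_irrepGen (hω : IsPrimitiveRoot ω ℓ) (μ : Multipartition ℓ n) :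
    starUnit μ * flipAlg ℓ n (irrepGen hω μ.star) = irrepGen hω μ * starUnit μ := by
  rw [irrepGen, irrepGen, map_mul, map_mul, ← mul_assoc, starUnit_mul_charSym, mul_assoc,
    ← mul_assoc (starUnit μ), starUnit_mul_rowSym, mul_assoc μ.rowSym, starUnit_mul_colSym]
  simp only [mul_assoc]

theorem flipMulEquiv_mul_irrepGen (hω : IsPrimitiveRoot ω ℓ) (μ : Multipartition ℓ n)
    (a : MonoidAlgebra ℂ (Wreath ℓ n)) :
    flipMulEquiv μ (a * irrepGen hω μ.star) = flipMulEquiv μ a * irrepGen hω μ := by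
  have h1 : flipAlg ℓ n (irrepGen hω μ.star) * starUnitInv μ = starUnitInv μ * irrepGen hω μ := by
    calc _ = starUnitInv μ * (starUnit μ * flipAlg ℓ n (irrepGen hω μ.star)) * starUnitInv μ := by
          rw [← mul_assoc (starUnitInv μ), starUnitInv_mul_starUnit, one_mul]
      _ = _ := by
          rw [starUnit_mul_irrepGen, mul_assoc, mul_assoc, starUnit_mul_starUnitInv, mul_one]
  rw [flipMulEquiv_apply, flipMulEquiv_apply, map_mul, mul_assoc, h1, mul_assoc]

theorem flipMulEquiv_mem_iff (hω : IsPrimitiveRoot ω ℓ) (μ : Multipartition ℓ n)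
    (x : MonoidAlgebra ℂ (Wreath ℓ n)) :
    flipMulEquiv μ x ∈ Ideal.span {irrepGen hω μ} ↔ x ∈ Ideal.span {irrepGen hω μ.star} := by
  rw [Ideal.mem_span_singleton', Ideal.mem_span_singleton', (flipMulEquiv μ).surjective.exists]
  simp only [← flipMulEquiv_mul_irrepGen, EmbeddingLike.apply_eq_iff_eq]

/-- The isomorphism from `μ*` to the twist of `μ` by `Wreath.flip`. -/
def irrepEquiv (hω : IsPrimitiveRoot ω ℓ) (μ : Multipartition ℓ n) :
    Irrep hω μ.star ≃ₗ[ℂ] Irrep hω μ where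
  toFun x := ⟨flipMulEquiv μ x, (flipMulEquiv_mem_iff hω μ x).2 x.2⟩
  invFun y := ⟨(flipMulEquiv μ).symm y, (flipMulEquiv_mem_iff hω μ _).1 (by
    rw [LinearEquiv.apply_symm_apply]; exact y.2)⟩
  map_add' x y := Subtype.ext (map_add (flipMulEquiv μ) _ _)
  map_smul' a x := Subtype.ext (map_smul (flipMulEquiv μ) a _)
  left_inv x := Subtype.ext ((flipMulEquiv μ).symm_apply_apply _)
  right_inv y := Subtype.ext ((flipMulEquiv μ).apply_symm_apply _)

theorem irrepEquiv_of_smul (hω : IsPrimitiveRoot ω ℓ) (μ : Multipartition ℓ n) (w : Wreath ℓ n)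
    (v : Irrep hω μ.star) :
    irrepEquiv hω μ (MonoidAlgebra.of ℂ _ w • v) =
      MonoidAlgebra.of ℂ _ (Wreath.flip ℓ n w) • irrepEquiv hω μ v := by
  refine Subtype.ext ?_
  change flipAlg ℓ n (MonoidAlgebra.of ℂ _ w * v) * starUnitInv μ =
    MonoidAlgebra.of ℂ _ (Wreath.flip ℓ n w) * (flipAlg ℓ n v * starUnitInv μ)
  rw [map_mul, flipAlg_of, mul_assoc]

end Cherednik

end

theorem theorem4 (ℓ n : ℕ) [NeZero ℓ] (ω : ℂ) (hω : IsPrimitiveRoot ω ℓ)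
    (c : Cherednik.ReflParam (Cherednik.wreathRep n hω)) :
    (∀ μ : Cherednik.Multipartition ℓ n,
      ∃ Φ : Cherednik.AMinus (Cherednik.barParam c) (Cherednik.Irrep hω μ.star) ≃ₐ[ℂ]
          Cherednik.APlus c (Cherednik.Irrep hω μ),
        ∀ (d : ℤ) (f : Cherednik.AMinus (Cherednik.barParam c) (Cherednik.Irrep hω μ.star)),
          Cherednik.IsHomogeneousEnd (Cherednik.barParam c) (Cherednik.Irrep hω μ.star)
              (Cherednik.covectors (Fin n → ℂ)) d f ↔
            Cherednik.IsHomogeneousEnd c (Cherednik.Irrep hω μ)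
              (Cherednik.vectors (Fin n → ℂ)) (-d) (Φ f)) ∧
    (Cherednik.IsGeneric (Cherednik.barParam c) ↔ Cherednik.IsGeneric c) := by
  let F := Cherednik.wreathFourier c
  refine ⟨fun μ => ⟨F.endEquiv (Cherednik.irrepEquiv hω μ) (Cherednik.irrepEquiv_of_smul hω μ)
    F.snd_eq_zero_iff, fun d f => ?_⟩, F.isGeneric_iff⟩
  exact F.isHomogeneousEnd_iff _ _ F.snd_eq_zero_iff d f
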